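/- **Setting.** All graphs are finite, undirected, regular, without multiple edges or self-loops. Let $\Gamma=(V,E)$ be such a graph and $2\le n\le |V|$. For $A\subseteq V$ let $\partial A$ be the set of edges with one end in $A$ and the other in $V\setminus A$, and let $\delta A$ be the set of all vertices of $A$ having a neighbour in $V\setminus A$ together with all vertices of $V\setminus A$ having a neighbour in $A$. Put $$h_n(\Gamma)=\min\max_{1\le i\le n}\frac{|\partial A_i|}{|A_i|},\qquad \iota_n(\Gamma)=\min\max_{1\le i\le n}\frac{|\delta A_i|}{|A_i|},$$ where both minima are over all partitions $V=A_1\sqcup\dots\sqcup A_n$ into $n$ non-empty sets. For a sequence $(\Gamma_m)_{m\in\mathbb N}$ with $|V_m|\to\infty$, $\inf_m h_n(\Gamma_m)$ and $\inf_m\iota_n(\Gamma_m)$ denote the infima over all $m$ for which the quantity is defined, i.e. $|V_m|\ge n$. The sequence $(\Gamma_m)$ is a sequence of *$n$-way expanders* if the degrees of the $\Gamma_m$ are uniformly bounded, $|V_m|\to\infty$, and $\inf_m h_n(\Gamma_m)>0$; *expanders* are $2$-way expanders. **Corollary 1.2.** Let $(\Gamma_m)_{m\in\mathbb N}$, $\Gamma_m=(V_m,E_m)$,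 be a sequence of finite connected vertex-transitive graphs such that $\lim_{m\to\infty}|V_m|=\infty$ (the degrees need not be bounded). Then for every $n\ge 2$: 1. if $\inf_m h_{n+1}(\Gamma_m)>0$, then $\inf_m h_n(\Gamma_m)>0$; 2. if $\inf_m \iota_{n+1}(\Gamma_m)>0$, then $\inf_m \iota_n(\Gamma_m)>0$; 3. if $(\Gamma_m)$ is a sequence of $n$-way expanders, then it is a sequence of expanders. In particular, for every $n\ge2$, every sequence of finite connected Cayley graphs that is a sequence of $n$-way expanders is a sequence of expanders (an affirmative answer to Fujiwara's question). -/

import Mathlib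

open Filter

universe u v

namespace MultiwayExpander

section Constants

variable {V : Type u} [Fintype V]

open Classical in
/-- The edge boundary `∂(A, B)`, for disjoint `A` and `B`: the edges with one end in `A` and the
other in `B`. As `A` and `B` are disjoint, each such undirected edge is listed exactly once,
as the pair `(a, b)` with `a ∈ A` and `b ∈ B`. -/
noncomputable def edgeBoundary (G : SimpleGraph V) (A B : Finset V) : Finset (V × V) :=
  G.interedges A B

open Classical in
/-- The symmetric vertex boundary `δ(A, B)`, for disjoint `A` and `B`: the vertices of `A` with a
neighbour in `B`, together with the vertices of `B` with a neighbour in `A`. -/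
noncomputable def vertexBoundary (G : SimpleGraph V) (A B : Finset V) : Finset V :=
  {a ∈ A | ∃ b ∈ B, G.Adj a b} ∪ {b ∈ B | ∃ a ∈ A, G.Adj a b}

/-- `A 0, …, A (n - 1)` is a partition of the vertex set into `n` non-empty disjoint subsets. -/
structure IsPartition {n : ℕ} (A : Fin n → Finset V) : Prop where
  nonempty : ∀ i, (A i).Nonempty
  disjoint : ∀ i j, i ≠ j → Disjoint (A i) (A j)
  cover : ∀ v, ∃ i, v ∈ A i

open Classical in
/-- `max_i |∂ A_i| / |A_i|`, where `∂ A` is the edge boundary of `A` and its complement. -/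
noncomputable def maxEdgeRatio (G : SimpleGraph V) {n : ℕ} (A : Fin n → Finset V) : ℝ :=
  ⨆ i : Fin n, ((edgeBoundary G (A i) (A i)ᶜ).card : ℝ) / ((A i).card : ℝ)

open Classical in
/-- `max_i |δ A_i| / |A_i|`, where `δ A` is the symmetric vertex boundary of `A` and its
complement. -/
noncomputable def maxVertexRatio (G : SimpleGraph V) {n : ℕ} (A : Fin n → Finset V) : ℝ :=
  ⨆ i : Fin n, ((vertexBoundary G (A i) (A i)ᶜ).card : ℝ) / ((A i).card : ℝ)

/-- The `n`-way isoperimetric constant `h_n`, meaningful for `1 ≤ n ≤ |V|`: the minimum of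
`max_i |∂ A_i| / |A_i|` over all partitions of the vertex set into `n` non-empty subsets. -/
noncomputable def isoConst (n : ℕ) (G : SimpleGraph V) : ℝ :=
  ⨅ A : {A : Fin n → Finset V // IsPartition A}, maxEdgeRatio G A.1

/-- The `n`-way symmetric vertex isoperimetric constant `ι_n`, meaningful for `1 ≤ n ≤ |V|`: the
minimum of `max_i |δ A_i| / |A_i|` over all partitions of the vertex set into `n` non-empty
subsets. -/
noncomputable def vertexIsoConst (n : ℕ) (G : SimpleGraph V) : ℝ :=
  ⨅ A : {A : Fin n → Finset V // IsPartition A}, maxVertexRatio G A.1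

/-- Partitions into `n` non-empty subsets exist for `1 ≤ n ≤ |V|`. -/
theorem exists_isPartition {n : ℕ} (h1 : 1 ≤ n) (hn : n ≤ Fintype.card V) :
    ∃ A : Fin n → Finset V, IsPartition A := by
  classical
  haveI : Nonempty (Fin n) := ⟨⟨0, h1⟩⟩
  obtain ⟨e⟩ : Nonempty (Fin n ↪ V) :=
    Function.Embedding.nonempty_of_card_le (by simpa using hn)
  refine ⟨fun i => Finset.univ.filter fun v => Function.invFun e v = i, ?_, ?_, ?_⟩
  · intro i
    exact ⟨e i, by simp [Function.leftInverse_invFun e.injective i]⟩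
  · intro i j hij
    rw [Finset.disjoint_left]
    intro v hi hj
    simp only [Finset.mem_filter, Finset.mem_univ, true_and] at hi hj
    exact hij (hi.symm.trans hj)
  · intro v
    exact ⟨Function.invFun e v, by simp⟩

/-- The infimum that defines `h_n` is a minimum. -/
theorem isoConst_isLeast {n : ℕ} (G : SimpleGraph V) (h1 : 1 ≤ n) (hn : n ≤ Fintype.card V) :
    IsLeast (Set.range fun A : {A : Fin n → Finset V // IsPartition A} => maxEdgeRatio G A.1)
      (isoConst n G) := by
  obtain ⟨A, hA⟩ := exists_isPartition (V := V) h1 hn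
  haveI : Nonempty {A : Fin n → Finset V // IsPartition A} := ⟨⟨A, hA⟩⟩
  exact ⟨(Set.range_nonempty _).csInf_mem (Set.finite_range _),
    fun x hx => csInf_le (Set.finite_range _).bddBelow hx⟩

/-- The infimum that defines `ι_n` is a minimum. -/
theorem vertexIsoConst_isLeast {n : ℕ} (G : SimpleGraph V) (h1 : 1 ≤ n)
    (hn : n ≤ Fintype.card V) :
    IsLeast (Set.range fun A : {A : Fin n → Finset V // IsPartition A} => maxVertexRatio G A.1)
      (vertexIsoConst n G) := by
  obtain ⟨A, hA⟩ := exists_isPartition (V := V) h1 hn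
  haveI : Nonempty {A : Fin n → Finset V // IsPartition A} := ⟨⟨A, hA⟩⟩
  exact ⟨(Set.range_nonempty _).csInf_mem (Set.finite_range _),
    fun x hx => csInf_le (Set.finite_range _).bddBelow hx⟩

end Constants

/-- A graph is vertex-transitive if its automorphism group acts transitively on the vertices. -/
def IsVertexTransitive {V : Type u} (G : SimpleGraph V) : Prop :=
  ∀ v w : V, ∃ φ : G ≃g G, φ v = w

section Sequences

variable {V : ℕ → Type u} [∀ m, Fintype (V m)]

/-- `inf_m h_n(Γ_m)`, over all `m` for which `h_n(Γ_m)` is defined, that is, `n ≤ |V_m|`. -/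
noncomputable def infIsoConst (n : ℕ) (G : ∀ m, SimpleGraph (V m)) : ℝ :=
  ⨅ m : {m : ℕ // n ≤ Fintype.card (V m)}, isoConst n (G m.1)

/-- `inf_m ι_n(Γ_m)`, over all `m` for which `ι_n(Γ_m)` is defined, that is, `n ≤ |V_m|`. -/
noncomputable def infVertexIsoConst (n : ℕ) (G : ∀ m, SimpleGraph (V m)) : ℝ :=
  ⨅ m : {m : ℕ // n ≤ Fintype.card (V m)}, vertexIsoConst n (G m.1)

open Classical in
/-- A sequence of finite regular graphs `Γ_m` is a sequence of `n`-way expanders if the degrees are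
bounded, `|V_m| → ∞`, and `inf_m h_n(Γ_m) > 0`. -/
structure IsMultiwayExpanders (n : ℕ) (G : ∀ m, SimpleGraph (V m)) : Prop where
  bounded_degree : ∃ d : ℕ → ℕ, (∀ m, (G m).IsRegularOfDegree (d m)) ∧ BddAbove (Set.range d)
  card_tendsto : Tendsto (fun m => Fintype.card (V m)) atTop atTop
  inf_pos : 0 < infIsoConst n G

/-- A sequence of expanders (in the usual sense) is a sequence of `2`-way expanders. -/
def IsExpanders (G : ∀ m, SimpleGraph (V m)) : Prop :=
  IsMultiwayExpanders 2 G

end Sequences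

end MultiwayExpander

open MultiwayExpander

/-! Suppose every partition into `n + 1` parts has a part of boundary ratio at least `c`, and some
partition into `n` parts has all ratios at most `ε`, with `ε` tiny compared to `c / n ^ 2`.
Splitting one part by a set of small boundary must leave a very small piece (`le_or_le_of_split`).
Applied to translates of the parts, this shows that each automorphism permutes the labelling up to
few errors and relabelling by some `τ` (`exists_relabelling`). Hence a random automorphism separates
two given vertices with probability near 0 or near 1 (`separation_dichotomy`). Adjacent vertices are
rarely separated, and along a path the probability cannot jump over the gap, so by connectedness no
pair is often separated and one part contains most vertices (`exists_giant_part`). Translates of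
another part then lie mostly inside the giant part. Cutting the giant part along a well-chosen
translate yields `n + 1` parts of small ratio, a contradiction (`exists_lt_boundary`). Edge and
vertex boundaries are treated together through `IsBoundaryDensity`. -/

namespace MultiwayExpander

/-! ### Averages over the automorphism group. -/

section Averaging

variable {V : Type u} [Fintype V] {G : SimpleGraph V} [Fintype (G ≃g G)]

/-- The average of `f` over an orbit of a transitive automorphism group is the average of `f`. -/
theorem card_mul_sum_automorphisms (hG : IsVertexTransitive G) (f : V → ℝ) (u : V) :
    (Fintype.card V : ℝ) * ∑ k : G ≃g G, f (k u) = Fintype.card (G ≃g G) * ∑ v, f v := by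
  have key : ∀ w, ∑ k : G ≃g G, f (k w) = ∑ k : G ≃g G, f (k u) := by
    intro w
    obtain ⟨h, rfl⟩ := hG u w
    exact Fintype.sum_equiv (Equiv.mulRight h) _ _ fun k => rfl
  calc (Fintype.card V : ℝ) * ∑ k : G ≃g G, f (k u)
      = ∑ w, ∑ k : G ≃g G, f (k w) := by simp [key]
    _ = ∑ k : G ≃g G, ∑ w, f (k w) := Finset.sum_comm
    _ = ∑ k : G ≃g G, ∑ w, f w :=
        Finset.sum_congr rfl fun k _ => Equiv.sum_comp k.toEquiv f
    _ = Fintype.card (G ≃g G) * ∑ v, f v := by simp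

end Averaging

/-- A local density `β A v` of the boundary of `A` at the vertex `v`, which is subadditive and
invariant under automorphisms and bounds the presence of crossing edges. -/
structure IsBoundaryDensity {V : Type u} [Fintype V] [DecidableEq V] (G : SimpleGraph V)
    (β : Finset V → V → ℝ) : Prop where
  nonneg : ∀ A v, 0 ≤ β A v
  inter_le : ∀ A B v, β (A ∩ B) v ≤ (if v ∈ B then β A v else 0) + β B v
  sdiff_le : ∀ A B v, β (A \ B) v ≤ β A v + β B v
  preimage : ∀ (φ : G ≃g G) A v, β (Finset.univ.filter fun x => φ x ∈ A) v = β A (φ v)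
  one_le : ∀ A v w, v ∈ A → w ∉ A → G.Adj v w → 1 ≤ β A v

/-! ### Splitting parts and translating labellings. -/

section Labelling

variable {V : Type u} [Fintype V] [DecidableEq V] {G : SimpleGraph V}
  {β : Finset V → V → ℝ} {n : ℕ} {p : V → Fin n} {c ε : ℝ}

/-- The part of label `i` of a labelling of the vertices. -/
def labelPart {n : ℕ} (p : V → Fin n) (i : Fin n) : Finset V :=
  Finset.univ.filter fun x => p x = i

omit [DecidableEq V] in
@[simp] theorem mem_labelPart {i : Fin n} {x : V} : x ∈ labelPart p i ↔ p x = i := by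
  simp [labelPart]

theorem sum_card_labelPart_inter (p : V → Fin n) (S : Finset V) :
    ∑ i, ((S ∩ labelPart p i).card : ℝ) = S.card := by
  have h := Finset.card_eq_sum_card_fiberwise (f := p) (s := S) (t := Finset.univ) (by simp)
  rw [h, Nat.cast_sum]
  refine Finset.sum_congr rfl fun i _ => ?_
  congr 2
  ext x
  simp

theorem sum_card_labelPart (p : V → Fin n) :
    ∑ i, ((labelPart p i).card : ℝ) = Fintype.card V := by
  simpa using sum_card_labelPart_inter p Finset.univ

/-- If every partition into `n + 1` parts has a part of large boundary, then a part of a partition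
into `n` parts of small boundary cannot be split into two parts of small boundary. -/
theorem le_or_le_of_split
    (hc : ∀ q : V → Fin (n + 1), Function.Surjective q →
      ∃ i, c * (labelPart q i).card ≤ ∑ v, β (labelPart q i) v)
    (hp : Function.Surjective p) (hlt : ε < c)
    (hε : ∀ i, ∑ v, β (labelPart p i) v ≤ ε * (labelPart p i).card)
    (j : Fin n) (S : Finset V)
    (h1 : (labelPart p j ∩ S).Nonempty) (h2 : (labelPart p j \ S).Nonempty) :
    c * (labelPart p j ∩ S).card ≤ ∑ v, β (labelPart p j ∩ S) v ∨
    c * (labelPart p j \ S).card ≤ ∑ v, β (labelPart p j \ S) v := by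
  let q : V → Fin (n + 1) := fun x => if p x = j ∧ x ∈ S then Fin.last n else (p x).castSucc
  have hlast : labelPart q (Fin.last n) = labelPart p j ∩ S := by
    ext x
    by_cases h : p x = j ∧ x ∈ S
    · simp [q, h]
    · have := (Fin.castSucc_lt_last (p x)).ne
      simp [q, h, this]
  have hj : labelPart q j.castSucc = labelPart p j \ S := by
    ext x
    by_cases h : p x = j ∧ x ∈ S
    · have := (Fin.castSucc_lt_last j).ne'
      simp [q, h, this]
    · simp only [q, h, mem_labelPart, Finset.mem_sdiff, if_false, Fin.castSucc_inj]
      tauto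
  have hi : ∀ i, i ≠ j → labelPart q i.castSucc = labelPart p i := by
    intro i hij
    ext x
    by_cases h : p x = j ∧ x ∈ S
    · have := (Fin.castSucc_lt_last i).ne'
      simp [q, h, this, hij.symm]
    · simp [q, h]
  have hq : Function.Surjective q := by
    intro i
    induction i using Fin.lastCases with
    | last =>
      obtain ⟨x, hx⟩ := hlast ▸ h1
      exact ⟨x, mem_labelPart.1 hx⟩
    | cast i =>
      by_cases hij : i = j
      · subst hij
        obtain ⟨x, hx⟩ := hj ▸ h2
        exact ⟨x, mem_labelPart.1 hx⟩
      · obtain ⟨x, hx⟩ := hp i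
        exact ⟨x, mem_labelPart.1 (hi i hij ▸ mem_labelPart.2 hx)⟩
  obtain ⟨i, h⟩ := hc q hq
  induction i using Fin.lastCases with
  | last => exact Or.inl (hlast ▸ h)
  | cast i =>
    by_cases hij : i = j
    · subst hij
      exact Or.inr (hj ▸ h)
    -- An untouched part has ratio at most `ε < c`, so it cannot be the large one.
    · rw [hi i hij] at h
      obtain ⟨x, hx⟩ := hp i
      have hpos : (0 : ℝ) < (labelPart p i).card := by
        exact_mod_cast Finset.card_pos.2 ⟨x, mem_labelPart.2 hx⟩
      nlinarith [hε i]

/-- Only the boundary of `A` lying inside `B` is charged. When `B` runs over the translates of a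
small set, this is on average only a share proportional to the size of `B`. -/
theorem IsBoundaryDensity.sum_inter_le (hβ : IsBoundaryDensity G β) (A B : Finset V) :
    ∑ v, β (A ∩ B) v ≤ ∑ v ∈ B, β A v + ∑ v, β B v := by
  calc ∑ v, β (A ∩ B) v ≤ ∑ v, ((if v ∈ B then β A v else 0) + β B v) :=
        Finset.sum_le_sum fun v _ => hβ.inter_le A B v
    _ = _ := by simp [Finset.sum_add_distrib, Finset.sum_ite_mem]

theorem IsBoundaryDensity.sum_sdiff_le (hβ : IsBoundaryDensity G β) (A B : Finset V) :
    ∑ v, β (A \ B) v ≤ ∑ v, β A v + ∑ v, β B v := by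
  rw [← Finset.sum_add_distrib]
  exact Finset.sum_le_sum fun v _ => hβ.sdiff_le A B v

theorem IsBoundaryDensity.sum_nonneg (hβ : IsBoundaryDensity G β) (A : Finset V) :
    0 ≤ ∑ v, β A v :=
  Finset.sum_nonneg fun v _ => hβ.nonneg A v

theorem IsBoundaryDensity.labelPart_comp (hβ : IsBoundaryDensity G β) (φ : G ≃g G) (i : Fin n)
    (v : V) : β (labelPart (p ∘ φ) i) v = β (labelPart p i) (φ v) := by
  rw [← hβ.preimage]
  congr 1
  ext x
  simp

theorem IsBoundaryDensity.sum_labelPart_comp (hβ : IsBoundaryDensity G β) (φ : G ≃g G)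
    (i : Fin n) : ∑ v, β (labelPart (p ∘ φ) i) v = ∑ v, β (labelPart p i) v := by
  simp_rw [hβ.labelPart_comp]
  exact Equiv.sum_comp φ.toEquiv (β (labelPart p i))

omit [DecidableEq V] in
theorem card_labelPart_comp (φ : G ≃g G) (i : Fin n) :
    (labelPart (p ∘ φ) i).card = (labelPart p i).card := by
  refine Finset.card_equiv φ.toEquiv fun x => ?_
  simp

/-- Each part is either almost disjoint from a set of small boundary or almost contained in it. -/
theorem IsBoundaryDensity.inter_small_or_sdiff_small (hβ : IsBoundaryDensity G β)
    (hc : ∀ q : V → Fin (n + 1), Function.Surjective q →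
      ∃ i, c * (labelPart q i).card ≤ ∑ v, β (labelPart q i) v)
    (hp : Function.Surjective p) (hlt : ε < c)
    (hε : ∀ i, ∑ v, β (labelPart p i) v ≤ ε * (labelPart p i).card)
    (j : Fin n) (S : Finset V) :
    c * (labelPart p j ∩ S).card ≤ ∑ v, β (labelPart p j) v + ∑ v, β S v ∨
    c * (labelPart p j \ S).card ≤ ∑ v, β (labelPart p j) v + ∑ v, β S v := by
  have h0 := add_nonneg (hβ.sum_nonneg (labelPart p j)) (hβ.sum_nonneg S)
  rcases Finset.eq_empty_or_nonempty (labelPart p j ∩ S) with h1 | h1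
  · left; simpa [h1] using h0
  rcases Finset.eq_empty_or_nonempty (labelPart p j \ S) with h2 | h2
  · right; simpa [h2] using h0
  rcases le_or_le_of_split hc hp hlt hε j S h1 h2 with h | h
  · left
    refine h.trans ((hβ.sum_inter_le _ _).trans ?_)
    gcongr
    · intro i _ _; exact hβ.nonneg _ _
    · exact Finset.subset_univ S
  · exact Or.inr (h.trans (hβ.sum_sdiff_le _ _))

/-- A translate of the labelling is, up to relabelling, almost a function of the labelling. -/
theorem IsBoundaryDensity.exists_relabelling (hβ : IsBoundaryDensity G β)
    (hc : ∀ q : V → Fin (n + 1), Function.Surjective q →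
      ∃ i, c * (labelPart q i).card ≤ ∑ v, β (labelPart q i) v)
    (hp : Function.Surjective p) (hn : 1 ≤ n) (hc0 : 0 ≤ c) (hε0 : 0 ≤ ε) (hlt : ε < c)
    (hε : ∀ i, ∑ v, β (labelPart p i) v ≤ ε * (labelPart p i).card) (g : G ≃g G) :
    ∃ τ : Fin n → Fin n,
      c * ((Finset.univ.filter fun x => p (g x) ≠ τ (p x)).card : ℝ) ≤
        2 * n ^ 2 * ε * Fintype.card V := by
  have hn' : (1 : ℝ) ≤ n := by exact_mod_cast hn
  have hN : (0 : ℝ) ≤ Fintype.card V := Nat.cast_nonneg _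
  have hb : ∀ i, ∑ v, β (labelPart p i) v ≤ ε * Fintype.card V := fun i =>
    (hε i).trans (mul_le_mul_of_nonneg_left (by exact_mod_cast Finset.card_le_univ _) hε0)
  have hεN : 0 ≤ ε * (Fintype.card V : ℝ) := mul_nonneg hε0 hN
  have key : ∀ j, ∃ i, c * ((labelPart p j \ labelPart (p ∘ g) i).card : ℝ) ≤
      n * (2 * ε * Fintype.card V) := by
    intro j
    by_cases hex : ∃ i, c * ((labelPart p j \ labelPart (p ∘ g) i).card : ℝ) ≤
        2 * ε * Fintype.card V
    · obtain ⟨i, hi⟩ := hex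
      exact ⟨i, hi.trans (by nlinarith)⟩
    -- Here part `j` meets every translated part in a small set, so it is itself small and any value
    -- of `τ j` will do.
    · push Not at hex
      refine ⟨j, ?_⟩
      have hle : ∀ i, c * ((labelPart p j ∩ labelPart (p ∘ g) i).card : ℝ) ≤
          2 * ε * Fintype.card V := by
        intro i
        have hs := hβ.sum_labelPart_comp (p := p) g i
        rcases hβ.inter_small_or_sdiff_small hc hp hlt hε j (labelPart (p ∘ g) i) with h | h
        · linarith [hb i, hb j]
        · linarith [hb i, hb j, hex i]
      calc c * ((labelPart p j \ labelPart (p ∘ g) j).card : ℝ)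
          ≤ c * ((labelPart p j).card : ℝ) := by
            gcongr
            exact Finset.sdiff_subset
        _ = ∑ i, c * ((labelPart p j ∩ labelPart (p ∘ g) i).card : ℝ) := by
            rw [← Finset.mul_sum, sum_card_labelPart_inter]
        _ ≤ ∑ _i : Fin n, 2 * ε * Fintype.card V := Finset.sum_le_sum fun i _ => hle i
        _ = _ := by simp
  choose τ hτ using key
  refine ⟨τ, ?_⟩
  have hcard : ((Finset.univ.filter fun x => p (g x) ≠ τ (p x)).card : ℝ) =
      ∑ j, ((labelPart p j \ labelPart (p ∘ g) (τ j)).card : ℝ) := by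
    rw [← sum_card_labelPart_inter p]
    refine Finset.sum_congr rfl fun j _ => ?_
    congr 2
    ext x
    simp only [Finset.mem_inter, Finset.mem_filter, Finset.mem_univ, true_and, mem_labelPart,
      Finset.mem_sdiff, Function.comp_apply]
    constructor
    · rintro ⟨h, rfl⟩; exact ⟨rfl, h⟩
    · rintro ⟨rfl, h⟩; exact ⟨h, rfl⟩
  rw [hcard, Finset.mul_sum]
  calc _ ≤ ∑ _j : Fin n, (n : ℝ) * (2 * ε * Fintype.card V) :=
        Finset.sum_le_sum fun j _ => hτ j
    _ = _ := by simp; ring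

end Labelling

/-! ### Separation probabilities, the giant part, and the contradiction. -/

section Separation

variable {V : Type u} [Fintype V] [DecidableEq V] {G : SimpleGraph V} [Fintype (G ≃g G)]
  {β : Finset V → V → ℝ} {n : ℕ} {p : V → Fin n} {c ε : ℝ}

/-- The number of automorphisms that move `u` and `w` into different parts of a labelling. -/
noncomputable def separation (G : SimpleGraph V) [Fintype (G ≃g G)] (p : V → Fin n) (u w : V) : ℝ :=
  ∑ k : G ≃g G, if p (k u) = p (k w) then 0 else 1

omit [Fintype V] [DecidableEq V] in
theorem separation_triangle (u v w : V) :
    separation G p u w ≤ separation G p u v + separation G p v w := by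
  unfold separation
  rw [← Finset.sum_add_distrib]
  refine Finset.sum_le_sum fun k _ => ?_
  by_cases h1 : p (k u) = p (k v) <;> by_cases h2 : p (k v) = p (k w)
  · simp [h1, h2]
  all_goals simp only [h1, h2, if_true, if_false]; (try split_ifs) <;> norm_num

/-- If `k` separates the edge, then `k u` carries density at least 1 for its own part. As `k u` is
equidistributed, this happens with probability at most the mean total density. -/
theorem separation_le_of_adj (hβ : IsBoundaryDensity G β) (hG : IsVertexTransitive G)
    (hε : ∀ i, ∑ v, β (labelPart p i) v ≤ ε * (labelPart p i).card)
    {u w : V} (huw : G.Adj u w) : separation G p u w ≤ ε * Fintype.card (G ≃g G) := by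
  have hN : (0 : ℝ) < Fintype.card V := by exact_mod_cast Fintype.card_pos_iff.2 ⟨u⟩
  have h1 : separation G p u w ≤ ∑ k : G ≃g G, ∑ i, β (labelPart p i) (k u) := by
    refine Finset.sum_le_sum fun k _ => ?_
    split_ifs with h
    · exact Finset.sum_nonneg fun i _ => hβ.nonneg _ _
    · refine le_trans ?_ (Finset.single_le_sum (f := fun i => β (labelPart p i) (k u))
        (fun i _ => hβ.nonneg _ _) (Finset.mem_univ (p (k u))))
      exact hβ.one_le _ _ (k w) (by simp) (by simpa using Ne.symm h) (k.map_adj_iff.2 huw)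
  have h2 := card_mul_sum_automorphisms hG (fun v => ∑ i, β (labelPart p i) v) u
  have h3 : ∑ v, ∑ i, β (labelPart p i) v ≤ ε * Fintype.card V := by
    rw [Finset.sum_comm, ← sum_card_labelPart p, Finset.mul_sum]
    exact Finset.sum_le_sum fun i _ => hε i
  have hM : (0 : ℝ) ≤ Fintype.card (G ≃g G) := Nat.cast_nonneg _
  refine h1.trans (le_of_mul_le_mul_left ?_ hN)
  rw [h2]
  nlinarith [mul_le_mul_of_nonneg_left h3 hM]

/-- Two vertices are either almost always or almost never separated by a random automorphism. -/
theorem separation_dichotomy (hβ : IsBoundaryDensity G β) (hG : IsVertexTransitive G)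
    (hc : ∀ q : V → Fin (n + 1), Function.Surjective q →
      ∃ i, c * (labelPart q i).card ≤ ∑ v, β (labelPart q i) v)
    (hp : Function.Surjective p) (hn : 1 ≤ n) (hc0 : 0 ≤ c) (hε0 : 0 ≤ ε) (hlt : ε < c)
    (hε : ∀ i, ∑ v, β (labelPart p i) v ≤ ε * (labelPart p i).card) (u w : V) :
    c * (separation G p u w * (Fintype.card (G ≃g G) - separation G p u w)) ≤
      4 * n ^ 2 * ε * (Fintype.card (G ≃g G) : ℝ) ^ 2 := by
  have hN : (0 : ℝ) < Fintype.card V := by exact_mod_cast Fintype.card_pos_iff.2 ⟨u⟩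
  have hM : (0 : ℝ) ≤ Fintype.card (G ≃g G) := Nat.cast_nonneg _
  let d : (G ≃g G) → ℝ := fun k => if p (k u) = p (k w) then 0 else 1
  have hd : separation G p u w = ∑ k, d k := rfl
  -- For fixed `k`, the product `g * k` runs over the whole group, so the left side counts the pairs
  -- where `k` does not separate and `g * k` does.
  have hprod : separation G p u w * (Fintype.card (G ≃g G) - separation G p u w) =
      ∑ g : G ≃g G, ∑ k : G ≃g G, (1 - d k) * d (g * k) := by
    rw [Finset.sum_comm]
    have : ∀ k : G ≃g G, ∑ g : G ≃g G, (1 - d k) * d (g * k) =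
        (1 - d k) * separation G p u w := by
      intro k
      rw [← Finset.mul_sum, hd]
      congr 1
      exact Equiv.sum_comp (Equiv.mulRight k) d
    simp_rw [this]
    rw [← Finset.sum_mul, Finset.sum_sub_distrib, ← hd]
    simp [mul_comm]
  have hg : ∀ g : G ≃g G, c * ∑ k : G ≃g G, (1 - d k) * d (g * k) ≤
      4 * n ^ 2 * ε * Fintype.card (G ≃g G) := by
    intro g
    obtain ⟨τ, hτ⟩ := hβ.exists_relabelling hc hp hn hc0 hε0 hlt hε g
    let e : V → ℝ := fun x => if p (g x) = τ (p x) then 0 else 1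
    have hsum : ∑ x, e x = ((Finset.univ.filter fun x => p (g x) ≠ τ (p x)).card : ℝ) := by
      rw [Finset.card_filter]
      push_cast
      refine Finset.sum_congr rfl fun x _ => ?_
      by_cases h : p (g x) = τ (p x) <;> simp [e, h]
    -- If `k u` and `k w` share a label but their images under `g` do not, then `τ` errs at one of
    -- them.
    have hle : ∑ k : G ≃g G, (1 - d k) * d (g * k) ≤
        ∑ k : G ≃g G, e (k u) + ∑ k : G ≃g G, e (k w) := by
      rw [← Finset.sum_add_distrib]
      refine Finset.sum_le_sum fun k _ => ?_
      have hgu : (g * k) u = g (k u) := rfl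
      have hgw : (g * k) w = g (k w) := rfl
      simp only [d, e, hgu, hgw]
      split_ifs <;> grind
    have hu := card_mul_sum_automorphisms hG e u
    have hw := card_mul_sum_automorphisms hG e w
    rw [hsum] at hu hw
    refine le_of_mul_le_mul_left ?_ hN
    calc (Fintype.card V : ℝ) * (c * ∑ k : G ≃g G, (1 - d k) * d (g * k))
        ≤ Fintype.card V * (c * (∑ k : G ≃g G, e (k u) + ∑ k : G ≃g G, e (k w))) := by gcongr
      _ = c * (Fintype.card V * ∑ k : G ≃g G, e (k u) +
            Fintype.card V * ∑ k : G ≃g G, e (k w)) := by ring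
      _ = 2 * Fintype.card (G ≃g G) *
            (c * ((Finset.univ.filter fun x => p (g x) ≠ τ (p x)).card : ℝ)) := by
          rw [hu, hw]; ring
      _ ≤ 2 * Fintype.card (G ≃g G) * (2 * n ^ 2 * ε * Fintype.card V) := by gcongr
      _ = _ := by ring
  rw [hprod, Finset.mul_sum]
  calc _ ≤ ∑ _g : G ≃g G, 4 * (n : ℝ) ^ 2 * ε * Fintype.card (G ≃g G) :=
        Finset.sum_le_sum fun g _ => hg g
    _ = _ := by simp; ring

omit [Fintype V] [DecidableEq V] in
theorem card_automorphisms_pos : (0 : ℝ) < Fintype.card (G ≃g G) := by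
  exact_mod_cast Fintype.card_pos_iff.2 ⟨(1 : G ≃g G)⟩

/-- In a connected graph, small boundaries force all pairs of vertices to be rarely separated. -/
theorem separation_le (hβ : IsBoundaryDensity G β) (hG : IsVertexTransitive G)
    (hconn : G.Connected)
    (hc : ∀ q : V → Fin (n + 1), Function.Surjective q →
      ∃ i, c * (labelPart q i).card ≤ ∑ v, β (labelPart q i) v)
    (hp : Function.Surjective p) (hn : 1 ≤ n) (hc0 : 0 < c) (hε0 : 0 ≤ ε) (hlt : ε < c)
    (hεn : 64 * n ^ 2 * ε ≤ c) (hε8 : ε ≤ 1 / 8)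
    (hε : ∀ i, ∑ v, β (labelPart p i) v ≤ ε * (labelPart p i).card) (u w : V) :
    separation G p u w ≤ 1 / 8 * Fintype.card (G ≃g G) := by
  have hM := card_automorphisms_pos (G := G)
  have hself : separation G p u u = 0 := by simp [separation]
  -- The dichotomy gives `r * (M - r) ≤ M ^ 2 / 16`; if `r < M / 2`, then `M - r > M / 2` and so `r
  -- ≤ M / 8`.
  have hsmall : ∀ w, separation G p u w < 1 / 2 * Fintype.card (G ≃g G) →
      separation G p u w ≤ 1 / 8 * Fintype.card (G ≃g G) := by
    intro w h
    have hr : 0 ≤ separation G p u w := Finset.sum_nonneg fun k _ => by split_ifs <;> norm_num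
    have hdich := separation_dichotomy hβ hG hc hp hn hc0.le hε0 hlt hε u w
    set r := separation G p u w
    set M : ℝ := ((Fintype.card (G ≃g G) : ℕ) : ℝ)
    have h16 : c * (r * (M - r)) ≤ c * (1 / 16 * M ^ 2) := by
      refine hdich.trans ?_
      nlinarith [mul_le_mul_of_nonneg_right hεn (sq_nonneg M)]
    have h16' := le_of_mul_le_mul_left h16 hc0
    nlinarith
  have hreach := (SimpleGraph.reachable_iff_reflTransGen u w).1 (hconn.preconnected u w)
  induction hreach with
  | refl => rw [hself]; positivity
  | tail _ hadj ih =>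
    -- One more edge adds at most `ε ≤ 1 / 8`, giving at most `1 / 4`, still below the gap.
    refine hsmall _ ?_
    have h1 := separation_triangle (G := G) (p := p) u _ _ |>.trans
      (add_le_add_right (separation_le_of_adj hβ hG hε hadj) _)
    nlinarith [ih, mul_le_mul_of_nonneg_right hε8 hM.le]

/-- In a connected graph, small boundaries force some part to contain most vertices. -/
theorem exists_giant_part (hβ : IsBoundaryDensity G β) (hG : IsVertexTransitive G)
    (hconn : G.Connected)
    (hc : ∀ q : V → Fin (n + 1), Function.Surjective q →
      ∃ i, c * (labelPart q i).card ≤ ∑ v, β (labelPart q i) v)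
    (hp : Function.Surjective p) (hn : 1 ≤ n) (hc0 : 0 < c) (hε0 : 0 ≤ ε) (hlt : ε < c)
    (hεn : 64 * n ^ 2 * ε ≤ c) (hε8 : ε ≤ 1 / 8)
    (hε : ∀ i, ∑ v, β (labelPart p i) v ≤ ε * (labelPart p i).card) :
    ∃ i, 7 / 8 * (Fintype.card V : ℝ) ≤ (labelPart p i).card := by
  have hM := card_automorphisms_pos (G := G)
  obtain ⟨u⟩ := hconn.nonempty
  by_contra! hlt'
  have h1 : ∑ w, separation G p u w ≤
      ∑ _w : V, 1 / 8 * (Fintype.card (G ≃g G) : ℝ) := Finset.sum_le_sum fun w _ =>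
    separation_le hβ hG hconn hc hp hn hc0 hε0 hlt hεn hε8 hε u w
  -- For each `k`, the vertices separated from `u` are as many as those outside the part of `k u`.
  have h2 : ∑ w, separation G p u w =
      ∑ k : G ≃g G, ((Fintype.card V : ℝ) - (labelPart p (p (k u))).card) := by
    unfold separation
    rw [Finset.sum_comm]
    refine Finset.sum_congr rfl fun k _ => ?_
    rw [show ∑ w, (if p (k u) = p (k w) then (0 : ℝ) else 1) =
      ∑ w, (if p (k u) = p w then (0 : ℝ) else 1) from
      Equiv.sum_comp k.toEquiv fun w => if p (k u) = p w then (0 : ℝ) else 1]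
    have : ((labelPart p (p (k u))).card : ℝ) = ∑ w, if p (k u) = p w then (1 : ℝ) else 0 := by
      simp [labelPart, eq_comm]
    rw [this, eq_sub_iff_add_eq, ← Finset.sum_add_distrib]
    rw [Finset.sum_congr rfl fun w _ => show _ = (1 : ℝ) by split_ifs <;> norm_num]
    simp
  have h3 : ∑ _k : G ≃g G, 1 / 8 * (Fintype.card V : ℝ) <
      ∑ k : G ≃g G, ((Fintype.card V : ℝ) - (labelPart p (p (k u))).card) :=
    Finset.sum_lt_sum_of_nonempty ⟨1, Finset.mem_univ _⟩ fun k _ => by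
      linarith [hlt' (p (k u))]
  rw [← h2] at h3
  simp only [Finset.sum_const, Finset.card_univ, nsmul_eq_mul] at h1 h3
  linarith

/-- If every partition of a connected vertex-transitive graph into `n + 1` parts has a part of
large boundary, then so does every partition into `n` parts. -/
theorem exists_lt_boundary (hβ : IsBoundaryDensity G β) (hG : IsVertexTransitive G)
    (hconn : G.Connected)
    (hc : ∀ q : V → Fin (n + 1), Function.Surjective q →
      ∃ i, c * (labelPart q i).card ≤ ∑ v, β (labelPart q i) v)
    (hp : Function.Surjective p) (hn : 2 ≤ n) (hc0 : 0 < c) (hε0 : 0 < ε)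
    (hεn : 64 * n ^ 2 * ε ≤ c) (hε8 : ε ≤ 1 / 8) :
    ∃ i, ε * (labelPart p i).card < ∑ v, β (labelPart p i) v := by
  by_contra! hε
  have hM := card_automorphisms_pos (G := G)
  have hn' : (2 : ℝ) ≤ n := by exact_mod_cast hn
  have h4 : 4 * ε < c := by
    nlinarith [mul_le_mul_of_nonneg_right (pow_le_pow_left₀ (by norm_num) hn' 2) hε0.le]
  have hlt : ε < c := by linarith
  obtain ⟨j, hj⟩ := exists_giant_part hβ hG hconn hc hp (by omega) hc0 hε0.le hlt hεn hε8 hε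
  have : Nontrivial (Fin n) := Fin.nontrivial_iff_two_le.2 hn
  obtain ⟨i, hij⟩ := exists_ne j
  obtain ⟨x, hx⟩ := hp i
  have hN : (0 : ℝ) < Fintype.card V := by exact_mod_cast Fintype.card_pos_iff.2 ⟨x⟩
  set A := labelPart p j with hA
  set a : ℝ := ((labelPart p i).card : ℝ) with ha
  have hapos : 0 < a := by
    rw [ha]
    exact_mod_cast Finset.card_pos.2 ⟨x, mem_labelPart.2 hx⟩
  have haA : a + A.card ≤ Fintype.card V := by
    rw [ha, ← Nat.cast_add, ← Finset.card_union_of_disjoint]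
    · exact_mod_cast Finset.card_le_univ _
    · rw [Finset.disjoint_left]
      intro y hy hy'
      exact hij ((mem_labelPart.1 hy).symm.trans (mem_labelPart.1 hy'))
  have horbit : ∀ v, (Fintype.card V : ℝ) * ∑ g : G ≃g G,
      (if v ∈ labelPart (p ∘ g) i then (1 : ℝ) else 0) = Fintype.card (G ≃g G) * a := by
    intro v
    have h := card_mul_sum_automorphisms hG (fun y => if p y = i then (1 : ℝ) else 0) v
    rw [ha]
    simpa [labelPart] using h
  have hcard : (Fintype.card V : ℝ) * ∑ g : G ≃g G, ((A ∩ labelPart (p ∘ g) i).card : ℝ) =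
      Fintype.card (G ≃g G) * a * A.card := by
    have : ∀ g : G ≃g G, ((A ∩ labelPart (p ∘ g) i).card : ℝ) =
        ∑ v ∈ A, if v ∈ labelPart (p ∘ g) i then (1 : ℝ) else 0 := fun g => by
      rw [← Finset.filter_mem_eq_inter, Finset.card_filter]
      push_cast
      rfl
    simp_rw [this]
    rw [Finset.sum_comm, Finset.mul_sum, Finset.sum_congr rfl fun v _ => horbit v]
    simp [mul_comm]
  -- Each boundary point of `A` lies in a random translate with probability `a / |V|`, so `A`
  -- contributes at most `ε * a` on average, as does the translate itself.
  have hbd : (Fintype.card V : ℝ) * ∑ g : G ≃g G, ∑ v, β (A ∩ labelPart (p ∘ g) i) v ≤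
      Fintype.card (G ≃g G) * a * (2 * ε * Fintype.card V) := by
    have h1 : ∑ g : G ≃g G, ∑ v, β (A ∩ labelPart (p ∘ g) i) v ≤
        ∑ g : G ≃g G, ∑ v, β A v * (if v ∈ labelPart (p ∘ g) i then (1 : ℝ) else 0) +
        ∑ _g : G ≃g G, ∑ v, β (labelPart p i) v := by
      rw [← Finset.sum_add_distrib]
      refine Finset.sum_le_sum fun g _ => (hβ.sum_inter_le _ _).trans ?_
      rw [hβ.sum_labelPart_comp]
      refine add_le_add_left (le_of_eq ?_) _
      simp only [mul_ite, mul_one, mul_zero, Finset.sum_ite_mem, Finset.univ_inter]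
    have h2 : (Fintype.card V : ℝ) * ∑ g : G ≃g G, ∑ v, β A v *
        (if v ∈ labelPart (p ∘ g) i then (1 : ℝ) else 0) =
        Fintype.card (G ≃g G) * a * ∑ v, β A v := by
      rw [Finset.sum_comm, Finset.mul_sum, Finset.mul_sum]
      refine Finset.sum_congr rfl fun v _ => ?_
      rw [← Finset.mul_sum, mul_left_comm, horbit, mul_comm]
    have h3 : ∑ v, β A v ≤ ε * Fintype.card V :=
      (hε j).trans (by nlinarith)
    calc _ ≤ (Fintype.card V : ℝ) * _ := mul_le_mul_of_nonneg_left h1 hN.le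
      _ = Fintype.card (G ≃g G) * a * ∑ v, β A v +
          Fintype.card V * (Fintype.card (G ≃g G) * ∑ v, β (labelPart p i) v) := by
          rw [mul_add, h2]; simp
      _ ≤ Fintype.card (G ≃g G) * a * (ε * Fintype.card V) +
          Fintype.card V * (Fintype.card (G ≃g G) * (ε * a)) := by
          gcongr
          exact hε i
      _ = _ := by ring
  -- The mean boundary is at most `2 * ε * a` and the mean size at least `7 / 8 * a`, so some
  -- translate has ratio at most `16 / 7 * ε`.
  obtain ⟨g, hg⟩ : ∃ g : G ≃g G, ∑ v, β (A ∩ labelPart (p ∘ g) i) v <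
      4 * ε * ((A ∩ labelPart (p ∘ g) i).card : ℝ) := by
    by_contra! hge
    have h := Finset.sum_le_sum fun (g : G ≃g G) (_ : g ∈ Finset.univ) => hge g
    rw [← Finset.mul_sum] at h
    have h' := mul_le_mul_of_nonneg_left h hN.le
    rw [mul_left_comm, hcard] at h'
    have h'' := h'.trans hbd
    have hMa := mul_pos hM hapos
    have : 4 * ε * (A.card : ℝ) ≤ 2 * ε * Fintype.card V :=
      le_of_mul_le_mul_left (by linarith) hMa
    nlinarith [mul_pos hε0 hN]
  have hS : ((A ∩ labelPart (p ∘ g) i).card : ℝ) ≤ a := by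
    rw [ha, ← card_labelPart_comp (p := p) g i]
    exact_mod_cast Finset.card_le_card Finset.inter_subset_right
  have hsd : ((A ∩ labelPart (p ∘ g) i).card : ℝ) + (A \ labelPart (p ∘ g) i).card = A.card := by
    exact_mod_cast Finset.card_inter_add_card_sdiff A (labelPart (p ∘ g) i)
  have hne1 : (A ∩ labelPart (p ∘ g) i).Nonempty := by
    rw [← Finset.card_pos]
    have h := (hβ.sum_nonneg _).trans_lt hg
    exact_mod_cast (pos_iff_pos_of_mul_pos h).1 (by linarith)
  have hne2 : (A \ labelPart (p ∘ g) i).Nonempty := by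
    rw [← Finset.card_pos]
    have : (0 : ℝ) < (A \ labelPart (p ∘ g) i).card := by linarith
    exact_mod_cast this
  -- The intersection has ratio below `4 * ε < c`. The difference has at least `3 / 4 * |V|`
  -- vertices and boundary at most `ε * |V|`, again a ratio below `c`.
  rcases le_or_le_of_split hc hp hlt hε j (labelPart (p ∘ g) i) hne1 hne2 with h | h
  · nlinarith
  · have h1 := h.trans (hβ.sum_sdiff_le _ _)
    rw [hβ.sum_labelPart_comp] at h1
    nlinarith [hε i, hε j]

end Separation

/-! ### Edge and vertex boundaries as densities. -/

section Boundaries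

variable {V : Type u} [Fintype V]

open Classical in
/-- The neighbours of `v` on the other side of the partition `{A, Aᶜ}`. -/
noncomputable def crossing (G : SimpleGraph V) (A : Finset V) (v : V) : Finset V :=
  {w | G.Adj v w ∧ ¬(v ∈ A ↔ w ∈ A)}

@[simp] theorem mem_crossing {G : SimpleGraph V} {A : Finset V} {v w : V} :
    w ∈ crossing G A v ↔ G.Adj v w ∧ ¬(v ∈ A ↔ w ∈ A) := by
  simp [crossing]

/-- A subadditive function of the number of crossing edges at a vertex is a boundary density. -/
theorem isBoundaryDensity_crossing [DecidableEq V] (G : SimpleGraph V) (φ : ℕ → ℝ)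
    (h0 : φ 0 = 0) (hmono : Monotone φ) (hadd : ∀ a b, φ (a + b) ≤ φ a + φ b) (h1 : 1 ≤ φ 1) :
    IsBoundaryDensity G fun A v => φ (crossing G A v).card where
  nonneg A v := h0 ▸ hmono (Nat.zero_le _)
  inter_le A B v := by
    split_ifs with hv
    · refine (hmono ((Finset.card_le_card ?_).trans (Finset.card_union_le _ _))).trans (hadd _ _)
      intro w hw
      simp only [mem_crossing, Finset.mem_union, Finset.mem_inter] at hw ⊢
      tauto
    · rw [zero_add]
      refine hmono (Finset.card_le_card ?_)
      intro w hw
      simp only [mem_crossing, Finset.mem_inter] at hw ⊢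
      tauto
  sdiff_le A B v := by
    refine (hmono ((Finset.card_le_card ?_).trans (Finset.card_union_le _ _))).trans (hadd _ _)
    intro w hw
    simp only [mem_crossing, Finset.mem_union, Finset.mem_sdiff] at hw ⊢
    tauto
  preimage ψ A v := by
    congr 1
    refine Finset.card_equiv ψ.toEquiv fun w => ?_
    simpa using fun _ => ψ.map_adj_iff.symm
  one_le A v w hv hw hadj := by
    refine h1.trans (hmono (Finset.card_pos.2 ⟨w, ?_⟩))
    simp [hv, hw, hadj]

-- Each boundary edge is seen from both of its ends, hence the normalization `s = 2` for edge
-- boundaries.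
open Classical in
theorem sum_card_crossing (G : SimpleGraph V) (A : Finset V) :
    ∑ v, ((crossing G A v).card : ℝ) = 2 * ((edgeBoundary G A Aᶜ).card : ℝ) := by
  have key : ∀ B : Finset V,
      ∑ v ∈ B, (crossing G B v).card = (G.interedges B Bᶜ).card := by
    intro B
    rw [SimpleGraph.interedges_def, Finset.card_filter, Finset.sum_product]
    refine Finset.sum_congr rfl fun v hv => ?_
    rw [← Finset.card_filter]
    congr 1
    ext w
    simp [hv, and_comm]
  have hcompl : ∀ v, crossing G A v = crossing G Aᶜ v := fun v => by
    ext w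
    simp only [mem_crossing, Finset.mem_compl]
    tauto
  have h2 : ∑ v ∈ Aᶜ, (crossing G A v).card = (G.interedges A Aᶜ).card := by
    simp_rw [hcompl]
    rw [key, compl_compl]
    have := G.symm
    exact Rel.card_interedges_comm _ _
  have : ∑ v, (crossing G A v).card = 2 * (edgeBoundary G A Aᶜ).card := by
    rw [← Finset.sum_add_sum_compl A, key, h2, edgeBoundary, two_mul]
  exact_mod_cast this

open Classical in
theorem sum_crossing_indicator (G : SimpleGraph V) (A : Finset V) :
    ∑ v, (if (crossing G A v).card = 0 then (0 : ℝ) else 1) =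
      ((vertexBoundary G A Aᶜ).card : ℝ) := by
  have : vertexBoundary G A Aᶜ = Finset.univ.filter fun v => ¬(crossing G A v).card = 0 := by
    ext v
    rw [Finset.mem_filter, ← Ne, Finset.card_ne_zero]
    simp only [vertexBoundary, Finset.mem_union, Finset.mem_filter, Finset.mem_compl,
      Finset.mem_univ, true_and, Finset.Nonempty, mem_crossing]
    by_cases hv : v ∈ A
    · simp [hv, and_comm]
    · simp [hv, and_comm, G.adj_comm]
  rw [this, Finset.card_filter]
  push_cast
  refine Finset.sum_congr rfl fun v _ => ?_
  split_ifs <;> rfl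

end Boundaries

/-! ### From labellings back to partitions. -/

section Partitions

variable {V : Type u} [Fintype V] {n : ℕ}

theorem isPartition_labelPart {q : V → Fin n} (hq : Function.Surjective q) :
    IsPartition (labelPart q) where
  nonempty i := (hq i).imp fun _ hx => mem_labelPart.2 hx
  disjoint i j hij := by
    rw [Finset.disjoint_left]
    intro x hx hy
    exact hij ((mem_labelPart.1 hx).symm.trans (mem_labelPart.1 hy))
  cover v := ⟨q v, by simp⟩

theorem IsPartition.exists_labelling {A : Fin n → Finset V} (hA : IsPartition A) :
    ∃ p : V → Fin n, Function.Surjective p ∧ A = labelPart p := by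
  choose p hp using hA.cover
  have hmem : ∀ i x, x ∈ A i ↔ p x = i := by
    intro i x
    refine ⟨fun hx => ?_, fun h => h ▸ hp x⟩
    by_contra hne
    exact Finset.disjoint_left.1 (hA.disjoint _ _ hne) (hp x) hx
  refine ⟨p, fun i => ?_, ?_⟩
  · obtain ⟨x, hx⟩ := hA.nonempty i
    exact ⟨x, (hmem i x).1 hx⟩
  · ext i x
    simp [hmem]

/-- A uniform lower bound for the ratios of `n`-partitions in terms of one for
`(n + 1)`-partitions. -/
theorem le_iSup_ratio [DecidableEq V] {G : SimpleGraph V} {β : Finset V → V → ℝ}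
    (hβ : IsBoundaryDensity G β) (hG : IsVertexTransitive G) (hconn : G.Connected)
    {F : Finset V → ℝ} {s : ℝ} (hs : 0 < s) (hF : ∀ A, ∑ v, β A v = s * F A)
    (hn : 2 ≤ n) (hcard : n ≤ Fintype.card V) {c ε : ℝ} (hc0 : 0 < c) (hε0 : 0 < ε)
    (hεn : 64 * n ^ 2 * ε ≤ s * c) (hε8 : ε ≤ 1 / 8)
    (hc : n + 1 ≤ Fintype.card V → ∀ B : Fin (n + 1) → Finset V, IsPartition B →
      c ≤ ⨆ i, F (B i) / ((B i).card : ℝ))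
    {A : Fin n → Finset V} (hA : IsPartition A) :
    ε / s ≤ ⨆ i, F (A i) / ((A i).card : ℝ) := by
  obtain ⟨p, hp, rfl⟩ := hA.exists_labelling
  have hpos : ∀ i, (0 : ℝ) < (labelPart p i).card := fun i => by
    exact_mod_cast Finset.card_pos.2 (hA.nonempty i)
  suffices h : ∃ i, ε * (labelPart p i).card ≤ ∑ v, β (labelPart p i) v by
    obtain ⟨i, hi⟩ := h
    refine le_ciSup_of_le (Set.finite_range _).bddAbove i ?_
    rw [div_le_div_iff₀ hs (hpos i), mul_comm (F _), ← hF]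
    exact hi
  rcases hcard.eq_or_lt with heq | hlt
  -- When `n = |V|` there is no partition into `n + 1` parts to use, but the parts are singletons,
  -- and connectedness gives each vertex a neighbour outside its part.
  · have hinj : Function.Injective p :=
      ((Fintype.bijective_iff_surjective_and_card p).2 ⟨hp, by simp [heq]⟩).1
    have : Nontrivial V := Fintype.one_lt_card_iff_nontrivial.1 (by omega)
    obtain ⟨x⟩ := hconn.nonempty
    obtain ⟨w, hw⟩ := hconn.preconnected.exists_adj_of_nontrivial x
    refine ⟨p x, ?_⟩
    have hone : (labelPart p (p x)).card = 1 :=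
      Finset.card_eq_one.2 ⟨x, by ext y; simp [hinj.eq_iff]⟩
    have h1 := hβ.one_le (labelPart p (p x)) x w (by simp)
      (by simpa [hinj.eq_iff] using hw.ne') hw
    have h2 := Finset.single_le_sum (f := β (labelPart p (p x)))
      (fun v _ => hβ.nonneg _ v) (Finset.mem_univ x)
    rw [hone, Nat.cast_one]
    linarith
  · have : Finite (G ≃g G) := Finite.of_injective (fun φ : G ≃g G => φ.toEquiv)
      RelIso.toEquiv_injective
    have := Fintype.ofFinite (G ≃g G)
    obtain ⟨i, hi⟩ := exists_lt_boundary (n := n) (c := s * c) hβ hG hconn (fun q hq => by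
      have hB := isPartition_labelPart hq
      obtain ⟨i, hi⟩ := exists_eq_ciSup_of_finite
        (f := fun i => F (labelPart q i) / ((labelPart q i).card : ℝ))
      have h := hc hlt _ hB
      rw [← hi, le_div_iff₀ (by exact_mod_cast Finset.card_pos.2 (hB.nonempty i))] at h
      refine ⟨i, ?_⟩
      rw [hF, mul_assoc]
      exact mul_le_mul_of_nonneg_left h hs.le) hp hn (by positivity) hε0 hεn hε8
    exact ⟨i, hi.le⟩

end Partitions

/-! ### Uniform bounds along a sequence. -/

section Sequences

variable {V : ℕ → Type u} [∀ m, Fintype (V m)]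

/-- The bound `ε / s` depends only on `n`, `s` and the infimum `c`, not on the degree or size of the
graph, so it passes to the infimum over `m`. -/
theorem inf_pos_of_inf_succ_pos [∀ m, DecidableEq (V m)] {G : ∀ m, SimpleGraph (V m)}
    (hconn : ∀ m, (G m).Connected) (hG : ∀ m, IsVertexTransitive (G m))
    {β : ∀ m, Finset (V m) → V m → ℝ} (hβ : ∀ m, IsBoundaryDensity (G m) (β m))
    {F : ∀ m, Finset (V m) → ℝ} {s : ℝ} (hs : 0 < s)
    (hF : ∀ m A, ∑ v, β m A v = s * F m A) {n : ℕ} (hn : 2 ≤ n)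
    (h : 0 < ⨅ m : {m : ℕ // n + 1 ≤ Fintype.card (V m)},
      ⨅ A : {A : Fin (n + 1) → Finset (V m.1) // IsPartition A},
        ⨆ i, F m.1 (A.1 i) / ((A.1 i).card : ℝ)) :
    0 < ⨅ m : {m : ℕ // n ≤ Fintype.card (V m)},
      ⨅ A : {A : Fin n → Finset (V m.1) // IsPartition A},
        ⨆ i, F m.1 (A.1 i) / ((A.1 i).card : ℝ) := by
  have hF0 : ∀ m A, 0 ≤ F m A := fun m A =>
    nonneg_of_mul_nonneg_right (hF m A ▸ (hβ m).sum_nonneg A) hs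
  set c := ⨅ m : {m : ℕ // n + 1 ≤ Fintype.card (V m)},
      ⨅ A : {A : Fin (n + 1) → Finset (V m.1) // IsPartition A},
        ⨆ i, F m.1 (A.1 i) / ((A.1 i).card : ℝ) with hc
  have hcle : ∀ m, n + 1 ≤ Fintype.card (V m) → ∀ B : Fin (n + 1) → Finset (V m),
      IsPartition B → c ≤ ⨆ i, F m (B i) / ((B i).card : ℝ) := by
    intro m hm B hB
    refine (ciInf_le ⟨0, ?_⟩ (⟨m, hm⟩ : {m : ℕ // n + 1 ≤ Fintype.card (V m)})).trans
      (ciInf_le (Set.finite_range _).bddBelow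
        (⟨B, hB⟩ : {A : Fin (n + 1) → Finset (V m) // IsPartition A}))
    rintro _ ⟨m, rfl⟩
    exact Real.iInf_nonneg fun A => Real.iSup_nonneg fun i => div_nonneg (hF0 _ _) (by positivity)
  have hn0 : (0 : ℝ) < n := by exact_mod_cast (by omega : 0 < n)
  obtain ⟨ε, hε0, hεn, hε8⟩ : ∃ ε : ℝ, 0 < ε ∧ 64 * n ^ 2 * ε ≤ s * c ∧ ε ≤ 1 / 8 := by
    refine ⟨min (s * c / (64 * n ^ 2)) (1 / 8), by positivity, ?_, min_le_right _ _⟩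
    calc 64 * (n : ℝ) ^ 2 * min (s * c / (64 * n ^ 2)) (1 / 8)
        ≤ 64 * n ^ 2 * (s * c / (64 * n ^ 2)) := by gcongr; exact min_le_left _ _
      _ = s * c := by field_simp
  -- A real infimum over an empty index type is 0, so positivity of `c` rules this out.
  have hne : Nonempty {m : ℕ // n + 1 ≤ Fintype.card (V m)} := by
    by_contra hempty
    rw [not_nonempty_iff] at hempty
    rw [hc, Real.iInf_of_isEmpty] at h
    exact h.false
  obtain ⟨m₀, hm₀⟩ := hne
  have : Nonempty {m : ℕ // n ≤ Fintype.card (V m)} := ⟨⟨m₀, by omega⟩⟩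
  refine lt_of_lt_of_le (div_pos hε0 hs) (le_ciInf fun m => ?_)
  obtain ⟨A₀, hA₀⟩ := exists_isPartition (V := V m.1) (by omega : 1 ≤ n) m.2
  have : Nonempty {A : Fin n → Finset (V m.1) // IsPartition A} := ⟨⟨A₀, hA₀⟩⟩
  exact le_ciInf fun A => le_iSup_ratio (hβ m.1) (hG m.1) (hconn m.1) hs (hF m.1) hn m.2 h hε0
    hεn hε8 (hcle m.1) A.2

open Classical in
theorem infIsoConst_pos_of_succ {G : ∀ m, SimpleGraph (V m)}
    (hconn : ∀ m, (G m).Connected) (hG : ∀ m, IsVertexTransitive (G m)) {n : ℕ} (hn : 2 ≤ n)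
    (h : 0 < infIsoConst (n + 1) G) : 0 < infIsoConst n G := by
  exact inf_pos_of_inf_succ_pos hconn hG
    (fun m => isBoundaryDensity_crossing (G m) (fun k => (k : ℝ)) (by simp) Nat.mono_cast
      (by simp) (by simp)) two_pos
    (fun m A => sum_card_crossing (G m) A) hn h

-- The density is the crossing count truncated to 0 or 1, which is still monotone and subadditive.
open Classical in
theorem infVertexIsoConst_pos_of_succ {G : ∀ m, SimpleGraph (V m)}
    (hconn : ∀ m, (G m).Connected) (hG : ∀ m, IsVertexTransitive (G m)) {n : ℕ} (hn : 2 ≤ n)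
    (h : 0 < infVertexIsoConst (n + 1) G) : 0 < infVertexIsoConst n G := by
  refine inf_pos_of_inf_succ_pos hconn hG
    (fun m => isBoundaryDensity_crossing (G m) (fun k => if k = 0 then 0 else 1) (by simp)
      ?_ ?_ (by simp)) one_pos
    (fun m A => (sum_crossing_indicator (G m) A).trans (one_mul _).symm) hn h
  · intro a b hab
    dsimp only
    split_ifs <;> grind
  · intro a b
    split_ifs <;> grind

theorem IsMultiwayExpanders.isExpanders {G : ∀ m, SimpleGraph (V m)}
    (hconn : ∀ m, (G m).Connected) (hG : ∀ m, IsVertexTransitive (G m)) {n : ℕ} (hn : 2 ≤ n)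
    (h : IsMultiwayExpanders n G) : IsExpanders G := by
  induction n, hn using Nat.le_induction with
  | base => exact h
  | succ n hn ih =>
    exact ih ⟨h.bounded_degree, h.card_tendsto, infIsoConst_pos_of_succ hconn hG hn h.inf_pos⟩

end Sequences

theorem isVertexTransitive_mulCayley {H : Type v} [Group H] (S : Set H) :
    IsVertexTransitive (SimpleGraph.mulCayley S) := fun v w =>
  ⟨⟨Equiv.mulLeft (w * v⁻¹), SimpleGraph.mulCayley_adj_mul_iff_right⟩, by simp⟩

end MultiwayExpander

open MultiwayExpander

theorem corollary1p2 :
    -- finite connected vertex-transitive graphs with `|V_m| → ∞`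
    (∀ (V : ℕ → Type u) [∀ m, Fintype (V m)] (G : ∀ m, SimpleGraph (V m)),
      (∀ m, (G m).Connected) → (∀ m, IsVertexTransitive (G m)) →
      Tendsto (fun m => Fintype.card (V m)) atTop atTop →
      ∀ n : ℕ, 2 ≤ n →
        (0 < infIsoConst (n + 1) G → 0 < infIsoConst n G) ∧
        (0 < infVertexIsoConst (n + 1) G → 0 < infVertexIsoConst n G) ∧
        (IsMultiwayExpanders n G → IsExpanders G)) ∧
    -- finite connected Cayley graphs
    (∀ (H : ℕ → Type v) [∀ m, Group (H m)] [∀ m, Fintype (H m)] (S : ∀ m, Set (H m)),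
      (∀ m, (SimpleGraph.mulCayley (S m)).Connected) →
      ∀ n : ℕ, 2 ≤ n →
        IsMultiwayExpanders n (fun m => SimpleGraph.mulCayley (S m)) →
        IsExpanders (fun m => SimpleGraph.mulCayley (S m))) := by
  exact ⟨fun V _ G hconn hG _ n hn =>
      ⟨infIsoConst_pos_of_succ hconn hG hn, infVertexIsoConst_pos_of_succ hconn hG hn,
        fun h => h.isExpanders hconn hG hn⟩,
    fun H _ _ S hconn n hn h =>
      h.isExpanders hconn (fun m => isVertexTransitive_mulCayley (S m)) hn⟩
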